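/- For integers $r,s\ge 1$ and $n\ge 2$ let $$H(r,n,s)=\langle x_0,\dots,x_{n-1}\mid x_jx_{j+1}\cdots x_{j+r-1}=x_{j+r}x_{j+r+1}\cdots x_{j+r+s-1}\ (0\le j<n)\rangle,$$ with subscripts taken modulo $n$. A labelled oriented graph (LOG) is a finite graph (loops and multiple edges allowed) with vertex set $V$ and edge set $E$, together with maps $\iota,\tau,\lambda:E\to V$ giving the initial vertex, the terminal vertex and the label of each edge; its group is $\langle V\mid \tau(e)^{-1}\lambda(e)^{-1}\iota(e)\lambda(e)\ (e\in E)\rangle$. A connected LOG group is a group isomorphic to the group of a LOG whose underlying graph is non-empty and connected. **Corollary.** Let $r,s\ge 1$ and $n\ge 2$ be integers. Then $H(r,n,s)$ is a connected LOG group if and only if one of the following holds: 1. $r=s$ and $\gcd(n,r)=1$, in which case $H(r,n,s)$ is isomorphic to the $(n,r)$-torus knot group $\langle a,b\mid a^n=b^r\rangle$; 2. $|r-s|=2$, $\gcd(n,r,s)=2$, and either $r\equiv 0 \bmod n$ or $s\equiv 0\bmod n$, in which case $H(r,n,s)\cong\mathbb{Z}$. -/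

import Mathlib

/-- The relator `∏_{i<r} x_{j+iq} · (∏_{i<s} x_{j+k-1+iq})⁻¹`, subscripts modulo `n`. -/
def prishchepovRelator (r n k s q : ℕ) (j : ZMod n) : FreeGroup (ZMod n) :=
  ((List.range r).map fun i : ℕ =>
      FreeGroup.of (j + (i : ZMod n) * (q : ZMod n))).prod *
    (((List.range s).map fun i : ℕ =>
      FreeGroup.of (j + (k : ZMod n) - 1 + (i : ZMod n) * (q : ZMod n))).prod)⁻¹

/-- The Prishchepov group `P(r,n,k,s,q)`, for `n ≥ 1`: generators `x_j` and one relator for each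
`j` modulo `n`. -/
abbrev PrishchepovGroup (r n k s q : ℕ) : Type :=
  PresentedGroup (Set.range (prishchepovRelator r n k s q))

/-- The Campbell-Robertson group `H(r,n,s) = P(r,n,r+1,s,1)`. -/
abbrev HGroup (r n s : ℕ) : Type := PrishchepovGroup r n (r + 1) s 1

/-- The `(p,q)`-torus knot group `⟨a, b | a^p = b^q⟩` (for coprime `p, q ≥ 1`). -/
abbrev TorusKnotGroup (p q : ℕ) : Type :=
  PresentedGroup
    ({FreeGroup.of false ^ p * (FreeGroup.of true ^ q)⁻¹} : Set (FreeGroup Bool))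

/-- A labelled oriented graph: a finite graph (loops and multiple edges are allowed), each of whose
edges has an initial vertex, a terminal vertex, and a label that is again a vertex. -/
structure LabelledOrientedGraph where
  /-- The vertices. -/
  V : Type
  /-- The edges. -/
  E : Type
  finiteV : Finite V
  finiteE : Finite E
  /-- The initial vertex of an edge. -/
  ini : E → V
  /-- The terminal vertex of an edge. -/
  ter : E → V
  /-- The label of an edge. -/
  lab : E → V

namespace LabelledOrientedGraph

/-- The underlying undirected graph is non-empty and connected. -/
def Connected (Γ : LabelledOrientedGraph) : Prop :=
  Nonempty Γ.V ∧
    ∀ u v : Γ.V, Relation.EqvGen (fun a b => ∃ e : Γ.E, Γ.ini e = a ∧ Γ.ter e = b) u v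

/-- The relator `τ(e)⁻¹ λ(e)⁻¹ ι(e) λ(e)`. -/
def relator (Γ : LabelledOrientedGraph) (e : Γ.E) : FreeGroup Γ.V :=
  (FreeGroup.of (Γ.ter e))⁻¹ * (FreeGroup.of (Γ.lab e))⁻¹ *
    FreeGroup.of (Γ.ini e) * FreeGroup.of (Γ.lab e)

/-- The group of a labelled oriented graph: the vertices generate, the edges give relators. -/
abbrev LOGGroup (Γ : LabelledOrientedGraph) : Type := PresentedGroup (Set.range Γ.relator)

end LabelledOrientedGraph

/-- `G` is a connected LOG group: it is isomorphic to the group of some connected labelled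
oriented graph. -/
def IsConnectedLOGGroup (G : Type*) [Group G] : Prop :=
  ∃ Γ : LabelledOrientedGraph, Γ.Connected ∧ Nonempty (G ≃* Γ.LOGGroup)

/-! Vertices joined by an edge of a LOG give conjugate generators, so a connected LOG group has
infinite cyclic abelianization. For `H(r,n,r)` this forces `gcd(n,r) = 1`, since subscripts modulo
the gcd would otherwise give two independent classes.

For `r ≠ s` the abelianization is `ℤ[X]/(X^n - 1, f)`, with `f` the representer polynomial and `X`
the shift of subscripts. If it is `ℤ`, the shift acts by a unit `c`; `c = 1` would give `r = s`, so
`c = -1` and `X + 1 = u(X^n - 1) + v f`. Putting `X = 1` gives `r - s ∣ 2`. At a primitive `n`-th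
root of unity `ζ`, with `z = ζ^r` and `w = ζ^s`, it gives `|v(ζ)| |1 - 2z + zw| = |1 - ζ²| = |z -
w|`. Unless `z` or `w` is `1`, the second factor exceeds `|z - w|`; then every conjugate of the
nonzero algebraic integer `v(ζ)` has absolute value below one, which is impossible.

Conversely, in the exceptional case the relations collapse to `x_j x_{j+1} = 1`. For `r = s` coprime
to `n`, all words of length `r` equal one element `a`, and conjugation by `a` is the shift by `r`.
This yields both the torus knot presentation, with `b = x_0 ⋯ x_{n-1}`, and a LOG presentation,
obtained by splitting that conjugation into `r` conjugations by generators. -/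

/-! ### Estimates at roots of unity -/

open Polynomial in
/-- A polynomial with integer coefficients that does not vanish at a primitive `n`-th root of unity
has absolute value at least one at some complex primitive `n`-th root of unity. -/
theorem exists_isPrimitiveRoot_one_le_norm_aeval {n : ℕ} [NeZero n] (v : ℤ[X])
    (hv : ∀ ζ : ℂ, IsPrimitiveRoot ζ n → aeval ζ v ≠ 0) :
    ∃ ζ : ℂ, IsPrimitiveRoot ζ n ∧ 1 ≤ ‖aeval ζ v‖ := by
  have : NeZero (n : ℚ) := ⟨Nat.cast_ne_zero.2 (NeZero.ne n)⟩
  obtain ⟨z, hζ⟩ : ∃ z : CyclotomicField n ℚ, IsPrimitiveRoot z n :=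
    (CyclotomicField.isCyclotomicExtension n ℚ).exists_isPrimitiveRoot rfl (NeZero.ne n)
  have key (φ : CyclotomicField n ℚ →+* ℂ) :
      φ (aeval hζ.toInteger v : NumberField.RingOfIntegers (CyclotomicField n ℚ)) = aeval (φ z) v := by
    change φ.comp (algebraMap (NumberField.RingOfIntegers (CyclotomicField n ℚ)) _) _ = _
    rw [aeval_def, aeval_def, hom_eval₂]
    exact congrArg (fun f => eval₂ f (φ z) v) (RingHom.ext_int _ _)
  have hprim (φ : CyclotomicField n ℚ →+* ℂ) := hζ.map_of_injective φ.injective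
  have hne : aeval hζ.toInteger v ≠ 0 := by
    intro h
    obtain ⟨φ⟩ : Nonempty (CyclotomicField n ℚ →+* ℂ) := inferInstance
    refine hv _ (hprim φ) ?_
    rw [← key, h]
    simp
  -- The norm of a nonzero algebraic integer is a nonzero integer, so its conjugates cannot all lie
  -- inside the unit disc.
  obtain ⟨φ, hφ⟩ := NumberField.exists_conjugate_one_le_norm hne
  exact ⟨_, hprim φ, by rwa [← key]⟩

theorem Complex.normSq_one_sub_two_mul_add_mul {z : ℂ} (hz : ‖z‖ = 1) (w : ℂ) :
    ‖1 - 2 * z + z * w‖ ^ 2 = ‖z - w‖ ^ 2 + 4 * ((1 - z.re) * (1 - w.re)) := by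
  have hz' : z.re * z.re + z.im * z.im = 1 := by
    rw [← Complex.normSq_apply, Complex.normSq_eq_norm_sq, hz]; norm_num
  simp only [← Complex.normSq_eq_norm_sq, Complex.normSq_apply, Complex.add_re, Complex.sub_re,
    Complex.mul_re, Complex.one_re, Complex.re_ofNat, Complex.im_ofNat, Complex.add_im,
    Complex.sub_im, Complex.mul_im, Complex.one_im]
  linear_combination (3 + w.re * w.re + w.im * w.im - 4 * w.re) * hz'

theorem Complex.re_lt_one_of_norm_eq_one {z : ℂ} (hz : ‖z‖ = 1) (h1 : z ≠ 1) : z.re < 1 := by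
  refine lt_of_le_of_ne (hz ▸ Complex.re_le_norm z) fun h => h1 ?_
  have hz' : z.re * z.re + z.im * z.im = 1 := by
    rw [← Complex.normSq_apply, Complex.normSq_eq_norm_sq, hz]; norm_num
  rw [h] at hz'
  exact Complex.ext h (by simpa using hz')

theorem Complex.norm_sub_lt_norm_one_sub_two_mul_add_mul {z w : ℂ} (hz : ‖z‖ = 1) (hw : ‖w‖ = 1)
    (hz1 : z ≠ 1) (hw1 : w ≠ 1) : ‖z - w‖ < ‖1 - 2 * z + z * w‖ := by
  refine lt_of_pow_lt_pow_left₀ 2 (norm_nonneg _) ?_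
  rw [Complex.normSq_one_sub_two_mul_add_mul hz]
  have h1 := Complex.re_lt_one_of_norm_eq_one hz hz1
  have h2 := Complex.re_lt_one_of_norm_eq_one hw hw1
  have := mul_pos (sub_pos.2 h1) (sub_pos.2 h2)
  linarith

open Polynomial in
/-- The representer polynomial `(1 + ⋯ + X^(r-1)) - X^r (1 + ⋯ + X^(s-1))` of `H(r,n,s)`. -/
noncomputable def representerPolynomial (r s : ℕ) : ℤ[X] :=
  (∑ i ∈ Finset.range r, X ^ i) - X ^ r * ∑ i ∈ Finset.range s, X ^ i

open Polynomial in
theorem representerPolynomial_mul_one_sub (r s : ℕ) :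
    representerPolynomial r s * (1 - X) = 1 - 2 * X ^ r + X ^ (r + s) := by
  have h (k : ℕ) : (∑ i ∈ Finset.range k, (X : ℤ[X]) ^ i) * (1 - X) = 1 - X ^ k :=
    geom_sum_mul_neg _ _
  rw [representerPolynomial, sub_mul, mul_assoc, h, h]
  ring

-- If neither divisibility held, the strict inequality would apply at every primitive root, making
-- `|v(ζ)| < 1` throughout. The condition `2 < n` ensures `ζ² ≠ 1`, hence `v(ζ) ≠ 0`.
open Polynomial in
theorem dvd_or_dvd_of_representerPolynomial {r n s : ℕ} (hn : 2 < n)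
    (hrs : s = r + 2 ∨ r = s + 2) {u v : ℤ[X]}
    (h : X + 1 = u * (X ^ n - 1) + v * representerPolynomial r s) : n ∣ r ∨ n ∣ s := by
  by_contra! hdvd
  have : NeZero n := ⟨by omega⟩
  have key {ζ : ℂ} (hζ : IsPrimitiveRoot ζ n) :
      aeval ζ v * (1 - 2 * ζ ^ r + ζ ^ r * ζ ^ s) = 1 - ζ ^ 2 := by
    have h1 := congrArg (aeval ζ) (congrArg (· * (1 - X : ℤ[X])) h)
    have h2 := congrArg (aeval ζ) (representerPolynomial_mul_one_sub r s)
    simp only [map_mul, map_add, map_sub, map_pow, map_one, aeval_X, hζ.pow_eq_one, sub_self,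
      mul_zero, zero_add, map_ofNat] at h1 h2
    rw [mul_assoc, h2, pow_add] at h1
    linear_combination -h1
  have hsq {ζ : ℂ} (hζ : IsPrimitiveRoot ζ n) : 1 - ζ ^ 2 ≠ 0 := fun h0 => by
    have := Nat.le_of_dvd (by norm_num) (hζ.dvd_of_pow_eq_one 2 (sub_eq_zero.1 h0).symm)
    omega
  obtain ⟨ζ, hζ, hle⟩ := exists_isPrimitiveRoot_one_le_norm_aeval (n := n) v
    (fun ζ hζ h0 => hsq hζ (by rw [← key hζ, h0, zero_mul]))
  have hζ1 : ‖ζ‖ = 1 := hζ.norm'_eq_one (by omega)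
  have hpow (k : ℕ) : ‖ζ ^ k‖ = 1 := by rw [norm_pow, hζ1, one_pow]
  have hlt := Complex.norm_sub_lt_norm_one_sub_two_mul_add_mul (hpow r) (hpow s)
    (fun h0 => hdvd.1 (hζ.dvd_of_pow_eq_one r h0)) (fun h0 => hdvd.2 (hζ.dvd_of_pow_eq_one s h0))
  have heq : ‖ζ ^ r - ζ ^ s‖ = ‖1 - ζ ^ 2‖ := by
    rcases hrs with rfl | rfl
    · rw [show ζ ^ r - ζ ^ (r + 2) = ζ ^ r * (1 - ζ ^ 2) by ring, norm_mul, hpow, one_mul]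
    · rw [norm_sub_rev, show ζ ^ s - ζ ^ (s + 2) = ζ ^ s * (1 - ζ ^ 2) by ring, norm_mul, hpow,
        one_mul]
  have hmul := congrArg norm (key hζ)
  rw [norm_mul, ← heq] at hmul
  nlinarith [norm_nonneg (1 - 2 * ζ ^ r + ζ ^ r * ζ ^ s)]

/-! ### Cyclic words and maps out of the presentations -/

/-- The product `x_j x_{j+1} ⋯ x_{j+k-1}`. -/
def cyclicWord {G : Type*} [Monoid G] {n : ℕ} (x : ZMod n → G) (j : ZMod n) (k : ℕ) : G :=
  ((List.range k).map fun i : ℕ => x (j + (i : ZMod n))).prod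

section cyclicWord

variable {G H : Type*} {n : ℕ}

@[simp]
theorem cyclicWord_zero [Monoid G] (x : ZMod n → G) (j : ZMod n) : cyclicWord x j 0 = 1 := by
  simp [cyclicWord]

theorem cyclicWord_succ [Monoid G] (x : ZMod n → G) (j : ZMod n) (k : ℕ) :
    cyclicWord x j (k + 1) = cyclicWord x j k * x (j + k) := by
  simp [cyclicWord, List.range_succ]

theorem cyclicWord_one [Monoid G] (x : ZMod n → G) (j : ZMod n) : cyclicWord x j 1 = x j := by
  simp [cyclicWord]

theorem cyclicWord_add [Monoid G] (x : ZMod n → G) (j : ZMod n) (k l : ℕ) :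
    cyclicWord x j (k + l) = cyclicWord x j k * cyclicWord x (j + k) l := by
  induction l with
  | zero => simp
  | succ l ih => rw [← add_assoc, cyclicWord_succ, ih, cyclicWord_succ, mul_assoc]; simp [add_assoc]

theorem cyclicWord_succ' [Monoid G] (x : ZMod n → G) (j : ZMod n) (k : ℕ) :
    cyclicWord x j (k + 1) = x j * cyclicWord x (j + 1) k := by
  rw [add_comm, cyclicWord_add, cyclicWord_one, Nat.cast_one]

theorem map_cyclicWord [Monoid G] [Monoid H] (f : G →* H) (x : ZMod n → G) (j : ZMod n) (k : ℕ) :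
    f (cyclicWord x j k) = cyclicWord (fun i => f (x i)) j k := by
  simp [cyclicWord, map_list_prod, Function.comp_def]

theorem cyclicWord_shift [Monoid G] (x : ZMod n → G) (c j : ZMod n) (k : ℕ) :
    cyclicWord (fun i => x (i + c)) j k = cyclicWord x (j + c) k := by
  simp [cyclicWord, add_right_comm]

theorem cyclicWord_ofAdd {A : Type*} [AddCommGroup A] (a : ZMod n → A) (j : ZMod n) (k : ℕ) :
    cyclicWord (fun i => Multiplicative.ofAdd (a i)) j k =
      Multiplicative.ofAdd (∑ i ∈ Finset.range k, a (j + (i : ℕ))) := by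
  induction k with
  | zero => simp
  | succ k ih => rw [cyclicWord_succ, ih, Finset.sum_range_succ, ofAdd_add]

end cyclicWord

theorem lift_prishchepovRelator {G : Type*} [Group G] (r n s : ℕ) (x : ZMod n → G) (j : ZMod n) :
    FreeGroup.lift x (prishchepovRelator r n (r + 1) s 1 j) =
      cyclicWord x j r * (cyclicWord x (j + r) s)⁻¹ := by
  have h : j + ((r : ZMod n) + 1) - 1 = j + r := by ring
  simp [prishchepovRelator, cyclicWord, map_list_prod, Function.comp_def, h]

namespace HGroup

variable {G : Type*} [Group G] {r n s : ℕ}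

/-- The generator `x_j` of `H(r,n,s)`. -/
def gen (r n s : ℕ) (j : ZMod n) : HGroup r n s := PresentedGroup.of j

theorem cyclicWord_gen (r n s : ℕ) (j : ZMod n) :
    cyclicWord (gen r n s) j r = cyclicWord (gen r n s) (j + r) s := by
  have h : PresentedGroup.mk (Set.range (prishchepovRelator r n (r + 1) s 1))
      (prishchepovRelator r n (r + 1) s 1 j) = 1 :=
    PresentedGroup.one_of_mem ⟨j, rfl⟩
  have h2 : PresentedGroup.mk (Set.range (prishchepovRelator r n (r + 1) s 1)) =
      FreeGroup.lift (gen r n s) := by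
    ext j
    simp [gen, PresentedGroup.of]
  rw [h2, lift_prishchepovRelator] at h
  exact mul_inv_eq_one.1 h

/-- The homomorphism out of `H(r,n,s)` given by a family that satisfies the relations. -/
def lift (x : ZMod n → G) (hx : ∀ j, cyclicWord x j r = cyclicWord x (j + r) s) :
    HGroup r n s →* G :=
  PresentedGroup.toGroup (f := x) (by
    rintro _ ⟨j, rfl⟩
    rw [lift_prishchepovRelator, hx, mul_inv_cancel])

@[simp]
theorem lift_gen (x : ZMod n → G) (hx : ∀ j, cyclicWord x j r = cyclicWord x (j + r) s)
    (j : ZMod n) : lift x hx (gen r n s j) = x j :=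
  PresentedGroup.toGroup.of _

theorem hom_ext {φ ψ : HGroup r n s →* G} (h : ∀ j, φ (gen r n s j) = ψ (gen r n s j)) : φ = ψ :=
  PresentedGroup.ext h

/-- An isomorphism from `H(r,n,s)`, from a family satisfying the relations and an inverse. -/
def equivOfHom (x : ZMod n → G) (hx : ∀ j, cyclicWord x j r = cyclicWord x (j + r) s)
    (ψ : G →* HGroup r n s) (h : ∀ j, ψ (x j) = gen r n s j) (h' : (lift x hx).comp ψ = .id G) :
    HGroup r n s ≃* G :=
  MonoidHom.toMulEquiv (lift x hx) ψ (hom_ext fun j => by simp [h]) h'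

end HGroup

namespace LabelledOrientedGraph

variable {G : Type*} [Group G] (Γ : LabelledOrientedGraph)

/-- The generator of the group of a labelled oriented graph given by a vertex. -/
def gen (v : Γ.V) : Γ.LOGGroup := PresentedGroup.of v

theorem lift_relator (x : Γ.V → G) (e : Γ.E) : FreeGroup.lift x (Γ.relator e) =
    (x (Γ.ter e))⁻¹ * (x (Γ.lab e))⁻¹ * x (Γ.ini e) * x (Γ.lab e) := by
  simp [relator]

theorem gen_ter (e : Γ.E) :
    Γ.gen (Γ.ter e) = (Γ.gen (Γ.lab e))⁻¹ * Γ.gen (Γ.ini e) * Γ.gen (Γ.lab e) := by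
  have h : PresentedGroup.mk (Set.range Γ.relator) (Γ.relator e) = 1 :=
    PresentedGroup.one_of_mem ⟨e, rfl⟩
  have h2 : PresentedGroup.mk (Set.range Γ.relator) = FreeGroup.lift Γ.gen := by
    ext j
    simp [gen, PresentedGroup.of]
  rw [h2, lift_relator, mul_assoc, mul_assoc, inv_mul_eq_one] at h
  rw [h, mul_assoc]

/-- The homomorphism out of the group of a labelled oriented graph given by a family indexed by
the vertices that satisfies the relations. -/
def lift (x : Γ.V → G)
    (hx : ∀ e, x (Γ.ter e) = (x (Γ.lab e))⁻¹ * x (Γ.ini e) * x (Γ.lab e)) : Γ.LOGGroup →* G :=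
  PresentedGroup.toGroup (f := x) (by
    rintro _ ⟨e, rfl⟩
    rw [lift_relator, hx]
    group)

@[simp]
theorem lift_gen (x : Γ.V → G)
    (hx : ∀ e, x (Γ.ter e) = (x (Γ.lab e))⁻¹ * x (Γ.ini e) * x (Γ.lab e)) (v : Γ.V) :
    Γ.lift x hx (Γ.gen v) = x v :=
  PresentedGroup.toGroup.of _

theorem hom_ext {φ ψ : Γ.LOGGroup →* G} (h : ∀ v, φ (Γ.gen v) = ψ (Γ.gen v)) : φ = ψ :=
  PresentedGroup.ext h

theorem map_gen_eq {A : Type*} [CommGroup A] (hΓ : Γ.Connected) (φ : Γ.LOGGroup →* A)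
    (u v : Γ.V) : φ (Γ.gen u) = φ (Γ.gen v) := by
  induction hΓ.2 u v with
  | rel a b h =>
    obtain ⟨e, rfl, rfl⟩ := h
    rw [Γ.gen_ter e, map_mul, map_mul, map_inv]
    simp
  | refl => rfl
  | symm _ _ _ ih => exact ih.symm
  | trans _ _ _ _ _ ih₁ ih₂ => exact ih₁.trans ih₂

end LabelledOrientedGraph

/-! ### Abelianization of connected LOG groups -/

/-- The abelianization of a connected LOG group is infinite cyclic. -/
theorem IsConnectedLOGGroup.exists_hom_int {G : Type*} [Group G] (hG : IsConnectedLOGGroup G) :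
    ∃ φ : G →* Multiplicative ℤ, Function.Surjective φ ∧
      ∀ (A : Type) [CommGroup A] (ψ : G →* A), ∃ a : A, ∀ g, ψ g = a ^ (φ g).toAdd := by
  obtain ⟨Γ, hΓ, ⟨e⟩⟩ := hG
  obtain ⟨v₀⟩ := hΓ.1
  let φ : Γ.LOGGroup →* Multiplicative ℤ := Γ.lift (fun _ => Multiplicative.ofAdd 1) (by simp)
  have hφ (v : Γ.V) : φ (Γ.gen v) = Multiplicative.ofAdd 1 := Γ.lift_gen _ _ v
  refine ⟨φ.comp e.toMonoidHom, fun k => ⟨e.symm (Γ.gen v₀ ^ k.toAdd), ?_⟩, fun A _ ψ => ?_⟩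
  · simp only [MonoidHom.comp_apply, MulEquiv.coe_toMonoidHom, MulEquiv.apply_symm_apply,
      map_zpow, hφ, ← ofAdd_zsmul, smul_eq_mul, mul_one, ofAdd_toAdd]
  · refine ⟨ψ (e.symm (Γ.gen v₀)), fun g => ?_⟩
    have h : ψ.comp e.symm.toMonoidHom =
        (zpowersHom A (ψ (e.symm (Γ.gen v₀)))).comp φ := by
      refine Γ.hom_ext fun v => ?_
      rw [Γ.map_gen_eq hΓ _ v v₀, MonoidHom.comp_apply, MonoidHom.comp_apply, hφ]
      simp [zpowersHom_apply]
    have := DFunLike.congr_fun h (e g)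
    simpa [zpowersHom_apply] using this

theorem IsConnectedLOGGroup.of_mulEquiv {G H : Type*} [Group G] [Group H] (e : G ≃* H)
    (hH : IsConnectedLOGGroup H) : IsConnectedLOGGroup G := by
  obtain ⟨Γ, hΓ, ⟨f⟩⟩ := hH
  exact ⟨Γ, hΓ, ⟨e.trans f⟩⟩

theorem isConnectedLOGGroup_int : IsConnectedLOGGroup (Multiplicative ℤ) := by
  let Γ : LabelledOrientedGraph :=
    { V := Unit, E := Empty, finiteV := inferInstance, finiteE := inferInstance,
      ini := Empty.elim, ter := Empty.elim, lab := Empty.elim }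
  refine ⟨Γ, ⟨⟨()⟩, fun _ _ => .refl _⟩, ⟨MonoidHom.toMulEquiv
    (zpowersHom _ (Γ.gen ())) (Γ.lift (fun _ => Multiplicative.ofAdd 1) (fun e => e.elim)) ?_ ?_⟩⟩
  · ext
    simp [zpowersHom_apply]
  · refine Γ.hom_ext fun v => ?_
    simp [zpowersHom_apply]
    rfl

/-! ### Consequences of the relations -/

theorem ZMod.exists_natCast_mul_eq {n r : ℕ} [NeZero n] (h : n.Coprime r) (j : ZMod n) :
    ∃ k : ℕ, j = (k * r : ℕ) := by
  refine ⟨(j * (r : ZMod n)⁻¹).val, ?_⟩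
  rw [Nat.cast_mul, ZMod.natCast_zmod_val, mul_assoc, mul_comm _ (r : ZMod n),
    ZMod.coe_mul_inv_eq_one r h.symm, mul_one]

section family

variable {G : Type*} [Group G] {n r : ℕ} {x : ZMod n → G}

theorem cyclicWord_eq_of_coprime [NeZero n] (h : n.Coprime r)
    (hx : ∀ j, cyclicWord x j r = cyclicWord x (j + r) r) (j : ZMod n) :
    cyclicWord x j r = cyclicWord x 0 r := by
  obtain ⟨k, rfl⟩ := ZMod.exists_natCast_mul_eq h j
  induction k with
  | zero => simp
  | succ k ih => rw [← ih, hx ((k * r : ℕ) : ZMod n), Nat.succ_mul, Nat.cast_add]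

/-- The word of length `r + 1` at `j` can be split after its first letter or before its last; all
words of length `r` being equal, the two splittings compare `x_j` with `x_{j+r}`. -/
theorem apply_add_of_coprime [NeZero n] (h : n.Coprime r)
    (hx : ∀ j, cyclicWord x j r = cyclicWord x (j + r) r) (j : ZMod n) :
    x (j + r) = (cyclicWord x 0 r)⁻¹ * x j * cyclicWord x 0 r := by
  have h1 := cyclicWord_succ x j r
  rw [cyclicWord_succ', cyclicWord_eq_of_coprime h hx (j + 1)] at h1
  rw [mul_assoc, h1, cyclicWord_eq_of_coprime h hx j, inv_mul_cancel_left]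

theorem apply_mul_of_coprime [NeZero n] (h : n.Coprime r)
    (hx : ∀ j, cyclicWord x j r = cyclicWord x (j + r) r) (k : ℕ) :
    x (k * r : ℕ) = (cyclicWord x 0 r ^ k)⁻¹ * x 0 * cyclicWord x 0 r ^ k := by
  induction k with
  | zero => simp
  | succ k ih =>
    rw [Nat.succ_mul, Nat.cast_add, apply_add_of_coprime h hx, ih]
    group

theorem cyclicWord_mul_of_coprime [NeZero n] (h : n.Coprime r)
    (hx : ∀ j, cyclicWord x j r = cyclicWord x (j + r) r) (k : ℕ) :
    cyclicWord x 0 (k * r) = cyclicWord x 0 r ^ k := by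
  induction k with
  | zero => simp
  | succ k ih => rw [Nat.succ_mul, cyclicWord_add, ih, cyclicWord_eq_of_coprime h hx (0 + _), pow_succ]

theorem cyclicWord_mul_period (x : ZMod n → G) (k : ℕ) :
    cyclicWord x 0 (k * n) = cyclicWord x 0 n ^ k := by
  induction k with
  | zero => simp
  | succ k ih => rw [Nat.succ_mul, cyclicWord_add, ih, pow_succ]; simp

/-- If translation by `r` is conjugation by `x_0 ⋯ x_{r-1}` then all words of length `r` agree. -/
theorem cyclicWord_eq_of_conj [NeZero n]
    (hx : ∀ j, x (j + r) = (cyclicWord x 0 r)⁻¹ * x j * cyclicWord x 0 r) (j : ZMod n) :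
    cyclicWord x j r = cyclicWord x 0 r := by
  rw [← ZMod.natCast_zmod_val j]
  induction j.val with
  | zero => simp
  | succ k ih =>
    have h1 := cyclicWord_succ x k r
    rw [cyclicWord_succ', ih, hx, mul_assoc, mul_inv_cancel_left] at h1
    rw [Nat.cast_succ]
    exact mul_left_cancel h1

/-- In the exceptional case, consecutive generators of `H(r,n,s)` are mutually inverse. -/
theorem cyclicWord_two_eq_one {s : ℕ} (hx : ∀ j, cyclicWord x j r = cyclicWord x (j + r) s)
    (hrs : s = r + 2 ∨ r = s + 2) (hdvd : n ∣ r ∨ n ∣ s) (j : ZMod n) :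
    cyclicWord x j 2 = 1 := by
  simp only [← ZMod.natCast_eq_zero_iff] at hdvd
  -- The longer side is split into a word of length two and a word of the shorter length. The
  -- divisibility makes the latter start where the other side does, so it cancels.
  rcases hrs with rfl | rfl <;> rcases hdvd with h | h
  · have := hx j
    rw [cyclicWord_add, h, add_zero, add_zero] at this
    exact left_eq_mul.1 this
  · have := hx (j - r)
    rw [add_comm r 2, cyclicWord_add, sub_add_cancel,
      show j + ((2 : ℕ) : ZMod n) = j - r by
        push_cast at h ⊢
        linear_combination h] at this
    exact right_eq_mul.1 this
  · have := hx (j - s)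
    rw [cyclicWord_add, sub_add_cancel, h, add_zero] at this
    exact mul_eq_left.1 this
  · have := hx j
    rw [add_comm s 2, cyclicWord_add, Nat.cast_add, h, add_zero] at this
    exact mul_eq_right.1 this

end family

/-- The standard generators of the torus knot group satisfy its relation. -/
theorem TorusKnotGroup.of_pow_eq (p q : ℕ) :
    (PresentedGroup.of false : TorusKnotGroup p q) ^ p = PresentedGroup.of true ^ q := by
  have h := PresentedGroup.one_of_mem (rels :=
    ({FreeGroup.of false ^ p * (FreeGroup.of true ^ q)⁻¹} : Set (FreeGroup Bool))) rfl
  rw [map_mul, map_inv, map_pow, map_pow] at h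
  exact mul_inv_eq_one.1 h

/-! ### The torus knot group -/

section torus

variable {G : Type*} [Group G]

/-- The images in the torus knot group of the generators of `H(r,n,r)`. -/
def torusFamily (n α β : ℕ) (a b : G) (j : ZMod n) : G :=
  (a ^ (α * j.val))⁻¹ * ((b ^ β)⁻¹ * a ^ α) * a ^ (α * j.val)

/-- The element `a ^ n = b ^ r` commutes with `a` and `b`, so any representative of the subscript
may replace `j.val`. -/
theorem torusFamily_natCast {n r : ℕ} {a b : G} (hab : a ^ n = b ^ r) (α β N : ℕ) :
    torusFamily n α β a b N = (a ^ (α * N))⁻¹ * ((b ^ β)⁻¹ * a ^ α) * a ^ (α * N) := by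
  have hc : Commute (a ^ (n * (α * (N / n)))) ((b ^ β)⁻¹ * a ^ α) := by
    refine Commute.mul_right (Commute.inv_right ?_) (Commute.pow_pow_self _ _ _)
    rw [pow_mul, hab]
    exact ((Commute.pow_pow_self b r β).pow_left _)
  have hN : α * N = n * (α * (N / n)) + α * (N % n) := by
    conv_lhs => rw [← Nat.div_add_mod N n]
    ring
  rw [torusFamily, ZMod.val_natCast, hN, pow_add]
  generalize a ^ (n * (α * (N / n))) = y at hc
  generalize (b ^ β)⁻¹ * a ^ α = c at hc
  have : y⁻¹ * c * y = c := by rw [mul_assoc, ← hc.eq, inv_mul_cancel_left]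
  rw [mul_inv_rev]
  calc _ = (a ^ (α * (N % n)))⁻¹ * (y⁻¹ * c * y) * a ^ (α * (N % n)) := by rw [this]
    _ = _ := by group

/-- The product telescopes: the trailing power of `a` in each factor, together with its inner `a ^
α`, cancels the leading power of the next. -/
theorem cyclicWord_torusFamily {n r : ℕ} {a b : G} (hab : a ^ n = b ^ r) (α β N k : ℕ) :
    cyclicWord (torusFamily n α β a b) N k =
      (a ^ (α * N))⁻¹ * (b ^ (β * k))⁻¹ * a ^ (α * (N + k)) := by
  induction k with
  | zero => simp
  | succ k ih =>
    rw [cyclicWord_succ, ih, ← Nat.cast_add, torusFamily_natCast hab, Nat.mul_succ, ← Nat.add_assoc,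
      Nat.mul_succ α, add_comm (β * k), pow_add b, mul_inv_rev, add_comm (α * (N + k)) α,
      pow_add a α]
    simp only [mul_assoc, mul_inv_cancel_left]

theorem cyclicWord_torusFamily_eq {n r : ℕ} [NeZero n] {a b : G} (hab : a ^ n = b ^ r) {α β : ℕ}
    (hαβ : α * r = n * β + 1) (j : ZMod n) : cyclicWord (torusFamily n α β a b) j r = a := by
  rw [← ZMod.natCast_zmod_val j, cyclicWord_torusFamily hab, mul_comm β, pow_mul b, ← hab, ← pow_mul,
    mul_add α, hαβ]
  group

theorem cyclicWord_torusFamily_period {n r : ℕ} {a b : G} (hab : a ^ n = b ^ r) {α β : ℕ}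
    (hαβ : α * r = n * β + 1) : cyclicWord (torusFamily n α β a b) 0 n = b := by
  have := cyclicWord_torusFamily hab α β 0 n
  rw [Nat.cast_zero] at this
  rw [this, zero_add, mul_comm α n, pow_mul a n, hab, ← pow_mul, mul_comm r, hαβ, mul_comm β]
  group

end torus

theorem nonempty_mulEquiv_torusKnotGroup {n r : ℕ} (hn : 2 ≤ n) (h : n.Coprime r) :
    Nonempty (HGroup r n r ≃* TorusKnotGroup n r) := by
  have : NeZero n := ⟨by omega⟩
  obtain ⟨α, -, hα⟩ := Nat.exists_mul_mod_eq_one_of_coprime h.symm hn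
  have hαβ : α * r = n * (r * α / n) + 1 := by
    rw [← hα, Nat.div_add_mod, mul_comm]
  generalize r * α / n = β at hαβ
  have hab := TorusKnotGroup.of_pow_eq n r
  let g := HGroup.gen r n r
  have hg : ∀ j, cyclicWord g j r = cyclicWord g (j + r) r := HGroup.cyclicWord_gen r n r
  let f : Bool → HGroup r n r := fun t => if t then cyclicWord g 0 n else cyclicWord g 0 r
  let ψ : TorusKnotGroup n r →* HGroup r n r := PresentedGroup.toGroup (f := f) (by
    rintro _ rfl
    rw [map_mul, map_inv, map_pow, map_pow, FreeGroup.lift_apply_of, FreeGroup.lift_apply_of,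
      mul_inv_eq_one]
    simp only [f, if_true, Bool.false_eq_true, if_false]
    rw [← cyclicWord_mul_of_coprime h hg, ← cyclicWord_mul_period, mul_comm])
  have hψa : ψ (PresentedGroup.of false) = cyclicWord g 0 r := PresentedGroup.toGroup.of _
  have hψb : ψ (PresentedGroup.of true) = cyclicWord g 0 n := PresentedGroup.toGroup.of _
  have hx := cyclicWord_torusFamily_eq hab hαβ
  -- The word of length `α * r = n * β + 1` is `a ^ α`, and also `b ^ β` followed by `x_0`. This
  -- explains the shape of `torusFamily`.
  have h0 : g 0 = (cyclicWord g 0 n ^ β)⁻¹ * cyclicWord g 0 r ^ α := by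
    rw [← cyclicWord_mul_of_coprime h hg, hαβ, mul_comm n, cyclicWord_succ, cyclicWord_mul_period]
    simp
  refine ⟨HGroup.equivOfHom _ (fun j => (hx j).trans (hx _).symm) ψ (fun j => ?_) ?_⟩
  · have hj : j = ((α * j.val * r : ℕ) : ZMod n) := by
      rw [mul_right_comm, hαβ]
      simp
    change _ = g j
    conv_rhs => rw [hj, apply_mul_of_coprime h hg, h0]
    simp only [torusFamily, map_mul, map_inv, map_pow, hψa, hψb]
  · refine PresentedGroup.ext fun t => ?_
    cases t
    · rw [MonoidHom.comp_apply, hψa, map_cyclicWord]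
      simp only [g, HGroup.lift_gen, MonoidHom.id_apply]
      exact hx 0
    · rw [MonoidHom.comp_apply, hψb, map_cyclicWord]
      simp only [g, HGroup.lift_gen, MonoidHom.id_apply]
      exact cyclicWord_torusFamily_period hab hαβ

/-! ### The LOG presentation in the coprime case -/

/-- The labelled oriented graph of `H(r,n,r)`: the vertex `(j, i)` stands for the conjugate of `x_j`
by `x_0 ⋯ x_{i-1}`. -/
def torusLOG (n r : ℕ) [NeZero n] [NeZero r] : LabelledOrientedGraph where
  V := ZMod n × Fin r
  E := ZMod n × Fin r
  finiteV := inferInstance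
  finiteE := inferInstance
  ini e := e
  -- Conjugating in turn by `x_0, …, x_{r-1}` is conjugating by their product, which shifts by `r`;
  -- so row `j` ends at the start of row `j + r`.
  ter e := if h : e.2.val + 1 < r then (e.1, ⟨e.2 + 1, h⟩) else (e.1 + r, 0)
  lab e := ((e.2.val : ZMod n), 0)

theorem torusLOG_connected {n r : ℕ} [NeZero n] [NeZero r] (h : n.Coprime r) :
    (torusLOG n r).Connected := by
  let R : (torusLOG n r).V → (torusLOG n r).V → Prop :=
    fun a b => ∃ e : (torusLOG n r).E, (torusLOG n r).ini e = a ∧ (torusLOG n r).ter e = b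
  have h1 (j : ZMod n) (i : ℕ) (hi : i < r) :
      Relation.EqvGen R ((j, 0) : ZMod n × Fin r) ((j, ⟨i, hi⟩) : ZMod n × Fin r) := by
    induction i with
    | zero => exact .refl _
    | succ i ih =>
      exact .trans _ _ _ (ih (by omega))
        (.rel _ _ ⟨((j, ⟨i, by omega⟩) : ZMod n × Fin r), rfl, by simp [torusLOG, hi]⟩)
  have h2 (j : ZMod n) :
      Relation.EqvGen R ((j, 0) : ZMod n × Fin r) ((j + r, 0) : ZMod n × Fin r) := by
    have hr := NeZero.pos r
    refine .trans _ _ _ (h1 j (r - 1) (by omega))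
      (.rel _ _ ⟨((j, ⟨r - 1, by omega⟩) : ZMod n × Fin r), rfl, ?_⟩)
    have : ¬ (r - 1 + 1 < r) := by omega
    simp [torusLOG, this]
  have h3 (k : ℕ) :
      Relation.EqvGen R ((0, 0) : ZMod n × Fin r) (((k * r : ℕ), 0) : ZMod n × Fin r) := by
    induction k with
    | zero => rw [zero_mul, Nat.cast_zero]; exact .refl _
    | succ k ih =>
      rw [Nat.succ_mul, Nat.cast_add]
      exact .trans _ _ _ ih (h2 _)
  have h4 (v : ZMod n × Fin r) : Relation.EqvGen R ((0, 0) : ZMod n × Fin r) v := by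
    obtain ⟨j, i, hi⟩ := v
    obtain ⟨k, rfl⟩ := ZMod.exists_natCast_mul_eq h j
    exact .trans _ _ _ (h3 k) (h1 _ i hi)
  exact ⟨⟨((0, 0) : ZMod n × Fin r)⟩, fun u v => .trans _ _ _ (.symm _ _ (h4 u)) (h4 v)⟩

theorem torusLOG_gen {n r : ℕ} [NeZero n] [NeZero r] (j : ZMod n) (i : ℕ) (hi : i < r) :
    (torusLOG n r).gen ((j, ⟨i, hi⟩) : ZMod n × Fin r) =
      (cyclicWord (fun j => (torusLOG n r).gen ((j, 0) : ZMod n × Fin r)) 0 i)⁻¹ *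
        (torusLOG n r).gen ((j, 0) : ZMod n × Fin r) *
        cyclicWord (fun j => (torusLOG n r).gen ((j, 0) : ZMod n × Fin r)) 0 i := by
  induction i with
  | zero => rw [cyclicWord_zero, inv_one, one_mul, mul_one]; rfl
  | succ i ih =>
    have hi' : i < r := by omega
    have h := (torusLOG n r).gen_ter ((j, ⟨i, hi'⟩) : ZMod n × Fin r)
    have ht : (torusLOG n r).ter ((j, ⟨i, hi'⟩) : ZMod n × Fin r) =
      ((j, ⟨i + 1, hi⟩) : ZMod n × Fin r) := by simp [torusLOG, hi]
    have hini : (torusLOG n r).ini ((j, ⟨i, hi'⟩) : ZMod n × Fin r) =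
      ((j, ⟨i, hi'⟩) : ZMod n × Fin r) := rfl
    have hl : (torusLOG n r).lab ((j, ⟨i, hi'⟩) : ZMod n × Fin r) =
      (((i : ZMod n), 0) : ZMod n × Fin r) := rfl
    rw [ht, hini, hl, ih hi'] at h
    rw [h, cyclicWord_succ, zero_add]
    group

theorem torusLOG_gen_add {n r : ℕ} [NeZero n] [NeZero r] (j : ZMod n) :
    (torusLOG n r).gen ((j + r, 0) : ZMod n × Fin r) =
      (cyclicWord (fun j => (torusLOG n r).gen ((j, 0) : ZMod n × Fin r)) 0 r)⁻¹ *
        (torusLOG n r).gen ((j, 0) : ZMod n × Fin r) *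
        cyclicWord (fun j => (torusLOG n r).gen ((j, 0) : ZMod n × Fin r)) 0 r := by
  obtain ⟨i, hi⟩ := Nat.exists_eq_add_one_of_ne_zero (NeZero.ne r)
  have hir : i < r := by omega
  have h := (torusLOG n r).gen_ter ((j, ⟨i, hir⟩) : ZMod n × Fin r)
  have ht : (torusLOG n r).ter ((j, ⟨i, hir⟩) : ZMod n × Fin r) =
    ((j + r, 0) : ZMod n × Fin r) := by simp [torusLOG, ← hi]
  have hini : (torusLOG n r).ini ((j, ⟨i, hir⟩) : ZMod n × Fin r) =
    ((j, ⟨i, hir⟩) : ZMod n × Fin r) := rfl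
  have hl : (torusLOG n r).lab ((j, ⟨i, hir⟩) : ZMod n × Fin r) =
    (((i : ZMod n), 0) : ZMod n × Fin r) := rfl
  rw [ht, hini, hl, torusLOG_gen j i hir] at h
  have hw : ∀ x : ZMod n → (torusLOG n r).LOGGroup,
      cyclicWord x 0 r = cyclicWord x 0 i * x i := fun x =>
    (congrArg (cyclicWord x 0) hi).trans (by rw [cyclicWord_succ, zero_add])
  rw [h, hw]
  group

section torusLOGFamily

variable {G : Type*} [Group G] {n r : ℕ}

/-- The conjugates of `x_j` by `x_0 ⋯ x_{i-1}`. -/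
def torusLOGFamily (x : ZMod n → G) (v : ZMod n × Fin r) : G :=
  (cyclicWord x 0 v.2)⁻¹ * x v.1 * cyclicWord x 0 v.2

theorem torusLOGFamily_zero [NeZero r] (x : ZMod n → G) (j : ZMod n) :
    torusLOGFamily x (j, (0 : Fin r)) = x j := by
  simp [torusLOGFamily]

theorem torusLOGFamily_ter [NeZero n] [NeZero r] (h : n.Coprime r) (x : ZMod n → G)
    (hx : ∀ j, cyclicWord x j r = cyclicWord x (j + r) r) (v : ZMod n × Fin r) :
    torusLOGFamily x ((torusLOG n r).ter v) =
      (torusLOGFamily x ((torusLOG n r).lab v))⁻¹ * torusLOGFamily x ((torusLOG n r).ini v) *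
        torusLOGFamily x ((torusLOG n r).lab v) := by
  obtain ⟨j, i, hi⟩ := v
  change torusLOGFamily x (if h : i + 1 < r then (j, ⟨i + 1, h⟩) else (j + r, 0)) =
    (torusLOGFamily x ((i : ZMod n), (0 : Fin r)))⁻¹ * torusLOGFamily x (j, ⟨i, hi⟩) *
      torusLOGFamily x ((i : ZMod n), (0 : Fin r))
  have key : (torusLOGFamily x ((i : ZMod n), (0 : Fin r)))⁻¹ * torusLOGFamily x (j, ⟨i, hi⟩) *
      torusLOGFamily x ((i : ZMod n), (0 : Fin r)) =
      (cyclicWord x 0 (i + 1))⁻¹ * x j * cyclicWord x 0 (i + 1) := by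
    rw [torusLOGFamily_zero, cyclicWord_succ, zero_add]
    simp only [torusLOGFamily]
    group
  rw [key]
  split_ifs with h'
  · rfl
  · rw [torusLOGFamily_zero, apply_add_of_coprime h hx, show i + 1 = r by omega]

theorem map_torusLOGFamily {H : Type*} [Group H] (f : G →* H) (x : ZMod n → G)
    (v : ZMod n × Fin r) : f (torusLOGFamily x v) = torusLOGFamily (fun j => f (x j)) v := by
  simp only [torusLOGFamily, map_mul, map_inv, map_cyclicWord]

end torusLOGFamily

theorem isConnectedLOGGroup_of_coprime {n r : ℕ} (hn : n ≠ 0) (hr : r ≠ 0) (h : n.Coprime r) :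
    IsConnectedLOGGroup (HGroup r n r) := by
  have : NeZero n := ⟨hn⟩
  have : NeZero r := ⟨hr⟩
  have hg := HGroup.cyclicWord_gen r n r
  let z : ZMod n → (torusLOG n r).LOGGroup :=
    fun j => (torusLOG n r).gen ((j, 0) : ZMod n × Fin r)
  have hz (j : ZMod n) : cyclicWord z j r = cyclicWord z (j + r) r :=
    (cyclicWord_eq_of_conj (x := z) torusLOG_gen_add j).trans
      (cyclicWord_eq_of_conj (x := z) torusLOG_gen_add _).symm
  let ψ : (torusLOG n r).LOGGroup →* HGroup r n r :=
    (torusLOG n r).lift (torusLOGFamily (HGroup.gen r n r)) (torusLOGFamily_ter h _ hg)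
  have hψ (v : (torusLOG n r).V) :
      ψ ((torusLOG n r).gen v) = torusLOGFamily (HGroup.gen r n r) v :=
    LabelledOrientedGraph.lift_gen _ _ _ v
  refine ⟨torusLOG n r, torusLOG_connected h, ⟨HGroup.equivOfHom z hz ψ
    (fun j => (hψ _).trans (torusLOGFamily_zero _ j)) ?_⟩⟩
  refine (torusLOG n r).hom_ext fun v => ?_
  obtain ⟨j, i, hi⟩ : ZMod n × Fin r := v
  exact (congrArg _ (hψ _)).trans ((map_torusLOGFamily _ _ _).trans
    ((congrArg (torusLOGFamily · (j, ⟨i, hi⟩)) (funext (HGroup.lift_gen z hz))).trans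
      (torusLOG_gen j i hi).symm))

/-! ### The exceptional case -/

theorem ZMod.pow_val_add_natCast {R : Type*} [CommMonoid R] {n : ℕ} [NeZero n] {t : R}
    (ht : t ^ n = 1) (j : ZMod n) (i : ℕ) : t ^ (j + i).val = t ^ i * t ^ j.val := by
  have h (N : ℕ) : t ^ (N : ZMod n).val = t ^ N := by
    conv_rhs => rw [← Nat.div_add_mod N n, pow_add, pow_mul, ht, one_pow, one_mul]
    rw [ZMod.val_natCast]
  have := h (j.val + i)
  rw [Nat.cast_add, ZMod.natCast_zmod_val] at this
  rw [this, pow_add, mul_comm]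

theorem nonempty_mulEquiv_int {n r s : ℕ} (hn0 : n ≠ 0) (hn : Even n) (hr : Even r) (hs : Even s)
    (hrs : s = r + 2 ∨ r = s + 2) (hdvd : n ∣ r ∨ n ∣ s) :
    Nonempty (HGroup r n s ≃* Multiplicative ℤ) := by
  have : NeZero n := ⟨hn0⟩
  let g := HGroup.gen r n s
  have hg (j : ZMod n) : g (j + 1) = (g j)⁻¹ := by
    have := cyclicWord_two_eq_one (HGroup.cyclicWord_gen r n s) hrs hdvd j
    rw [cyclicWord_succ, cyclicWord_one, Nat.cast_one] at this
    exact eq_inv_of_mul_eq_one_right this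
  -- The signs alternate consistently around the cycle because `n` is even, and words of even length
  -- then sum to zero.
  let a : ZMod n → ℤ := fun j => (-1) ^ j.val
  have hw (j : ZMod n) {k : ℕ} (hk : Even k) :
      cyclicWord (fun i => Multiplicative.ofAdd (a i)) j k = 1 := by
    rw [cyclicWord_ofAdd]
    simp only [a, ZMod.pow_val_add_natCast hn.neg_one_pow]
    rw [← Finset.sum_mul, neg_one_geom_sum, if_pos hk, zero_mul, ofAdd_zero]
  refine ⟨HGroup.equivOfHom _ (fun j => (hw j hr).trans (hw _ hs).symm)
    (zpowersHom _ (g 0)) (fun j => ?_) ?_⟩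
  · change g 0 ^ a j = g j
    rw [← ZMod.natCast_zmod_val j]
    induction j.val with
    | zero => simp [a]
    | succ k ih =>
      rw [Nat.cast_succ, hg, ← ih, ← zpow_neg]
      have := ZMod.pow_val_add_natCast (hn.neg_one_pow (α := ℤ)) k 1
      rw [pow_one, neg_one_mul, Nat.cast_one] at this
      exact congrArg _ this
  · ext
    simp [zpowersHom_apply, g, a]

/-! ### Necessity of the conditions -/

open Polynomial in
theorem X_add_one_eq_of_isConnectedLOGGroup {n r s : ℕ} (hn : 2 ≤ n) (hrs : r ≠ s)
    (h : IsConnectedLOGGroup (HGroup r n s)) :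
    Even n ∧ Even r ∧ Even s ∧
      ∃ u v : ℤ[X], X + 1 = u * (X ^ n - 1) + v * representerPolynomial r s := by
  have : NeZero n := ⟨by omega⟩
  obtain ⟨φ, hφ, huniv⟩ := h.exists_hom_int
  let g := HGroup.gen r n s
  let a : ZMod n → ℤ := fun j => (φ (g j)).toAdd
  have hsum (j : ZMod n) : ∑ i ∈ Finset.range r, a (j + (i : ℕ)) =
      ∑ i ∈ Finset.range s, a (j + r + (i : ℕ)) := by
    have := congrArg φ (HGroup.cyclicWord_gen r n s j)
    rw [map_cyclicWord, map_cyclicWord] at this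
    have h2 := cyclicWord_ofAdd a j r
    have h3 := cyclicWord_ofAdd a (j + r) s
    exact Multiplicative.ofAdd.injective (h2.symm.trans (this.trans h3))
  have hne : ∃ j, a j ≠ 0 := by
    by_contra! h0
    have : φ = 1 := HGroup.hom_ext fun j => Multiplicative.toAdd.injective (h0 j)
    obtain ⟨x, hx⟩ := hφ (Multiplicative.ofAdd 1)
    rw [this, MonoidHom.one_apply] at hx
    exact zero_ne_one (Multiplicative.ofAdd.injective hx)
  -- Shifting subscripts preserves the relations, so `φ` precomposed with the shift is again a
  -- homomorphism to `ℤ`, hence a multiple of `φ`.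
  have hshift : ∃ c : ℤ, ∀ j, a (j + 1) = c * a j := by
    obtain ⟨c, hc⟩ := huniv (Multiplicative ℤ) (HGroup.lift (r := r) (s := s)
      (fun j => φ (g (j + 1))) (fun j => by
        have := congrArg φ (HGroup.cyclicWord_gen r n s (j + 1))
        rw [map_cyclicWord, map_cyclicWord, add_right_comm] at this
        rw [cyclicWord_shift (fun j => φ (g j)), cyclicWord_shift (fun j => φ (g j))]
        exact this))
    refine ⟨c.toAdd, fun j => ?_⟩
    have := congrArg Multiplicative.toAdd (hc (g j))
    rw [HGroup.lift_gen, toAdd_zpow, smul_eq_mul, mul_comm] at this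
    exact this
  obtain ⟨c, hc⟩ := hshift
  have hpow (j : ZMod n) (i : ℕ) : a (j + i) = c ^ i * a j := by
    induction i with
    | zero => simp
    | succ i ih => rw [Nat.cast_succ, ← add_assoc, hc, ih, pow_succ]; ring
  obtain ⟨j₀, hj₀⟩ := hne
  have hcn : c ^ n = 1 := by
    have := hpow j₀ n
    rw [ZMod.natCast_self, add_zero] at this
    exact (mul_eq_right₀ hj₀).1 this.symm
  have hsum' : ∑ i ∈ Finset.range r, c ^ i = c ^ r * ∑ i ∈ Finset.range s, c ^ i := by
    have := hsum j₀
    simp only [hpow] at this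
    rw [← Finset.sum_mul, ← Finset.sum_mul] at this
    exact mul_right_cancel₀ hj₀ (this.trans (by ring))
  have hc1 : c = -1 := by
    refine (Int.isUnit_iff.1 (IsUnit.of_pow_eq_one hcn (NeZero.ne n))).resolve_left ?_
    rintro rfl
    simp at hsum'
    omega
  subst hc1
  have hneven : Even n := (neg_one_pow_eq_one_iff_even (by norm_num)).1 hcn
  rw [neg_one_geom_sum, neg_one_geom_sum] at hsum'
  have hreven : Even r := by
    by_contra hr
    rw [if_neg hr, (Nat.not_even_iff_odd.1 hr).neg_one_pow] at hsum'
    split_ifs at hsum' <;> norm_num at hsum'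
  have hseven : Even s := by
    by_contra hs
    rw [if_pos hreven, if_neg hs, hreven.neg_one_pow] at hsum'
    norm_num at hsum'
  refine ⟨hneven, hreven, hseven, ?_⟩
  let I : Ideal ℤ[X] := Ideal.span {X ^ n - 1, representerPolynomial r s}
  let t : ℤ[X] ⧸ I := Ideal.Quotient.mk I X
  have ht : t ^ n = 1 := by
    rw [← map_pow, ← map_one (Ideal.Quotient.mk I), Ideal.Quotient.eq]
    exact Ideal.subset_span (by simp)
  have hf : ∑ i ∈ Finset.range r, t ^ i = (∑ i ∈ Finset.range s, t ^ i) * t ^ r := by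
    simp only [t, ← map_pow, ← map_sum, ← map_mul]
    rw [Ideal.Quotient.eq, mul_comm]
    exact Ideal.subset_span (by simp [representerPolynomial])
  -- The map `x_j ↦ t ^ j` also factors through `φ`, so the shift by `-1` on `φ` transfers to the
  -- quotient and gives `t = -1` there.
  obtain ⟨e, he⟩ := huniv (Multiplicative (ℤ[X] ⧸ I)) (HGroup.lift (r := r) (s := s)
    (fun j => Multiplicative.ofAdd (t ^ j.val)) (fun j => by
      rw [cyclicWord_ofAdd, cyclicWord_ofAdd]
      simp only [ZMod.pow_val_add_natCast ht]
      rw [← Finset.sum_mul, ← Finset.sum_mul, hf, mul_assoc]))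
  have he' (j : ZMod n) : t ^ j.val = a j • e.toAdd := by
    have := congrArg Multiplicative.toAdd (he (g j))
    rwa [HGroup.lift_gen, toAdd_zpow] at this
  have h0 := he' 0
  have h1 := ZMod.pow_val_add_natCast ht 0 1
  rw [he', Nat.cast_one, hc, neg_one_mul, neg_smul, ← h0, ZMod.val_zero, pow_zero, pow_one,
    mul_one] at h1
  have hmem : X + 1 ∈ I := by
    rw [← Ideal.Quotient.eq_zero_iff_mem, map_add, map_one]
    change t + 1 = 0
    rw [← h1, neg_add_cancel]
  obtain ⟨u, v, huv⟩ := Ideal.mem_span_pair.1 hmem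
  exact ⟨u, v, huv.symm⟩

theorem coprime_of_isConnectedLOGGroup {n r : ℕ} (hn : 2 ≤ n)
    (h : IsConnectedLOGGroup (HGroup r n r)) : Nat.gcd n r = 1 := by
  by_contra hd
  obtain ⟨φ, -, huniv⟩ := h.exists_hom_int
  let p : ZMod n →+* ZMod (n.gcd r) := ZMod.castHom (Nat.gcd_dvd_left n r) _
  have hpr : p r = 0 := by
    rw [map_natCast, ZMod.natCast_eq_zero_iff]
    exact Nat.gcd_dvd_right n r
  have : Fact (1 < n.gcd r) := ⟨by have := Nat.gcd_pos_of_pos_left r (by omega : 0 < n); omega⟩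
  -- Separating the subscripts divisible by the gcd from the rest respects the shift by `r`, and
  -- sends `x_0` and `x_1` to independent vectors of `ℤ × ℤ`.
  let x : ZMod n → Multiplicative (ℤ × ℤ) :=
    fun j => Multiplicative.ofAdd (if p j = 0 then (1, 0) else (0, 1))
  have hx (j : ZMod n) : x (j + r) = x j := by simp only [x, map_add, hpr, add_zero]
  obtain ⟨e, he⟩ := huniv _ (HGroup.lift (r := r) (s := r) x (fun j => by
    rw [← cyclicWord_shift]
    simp only [hx]))
  have h0 := congrArg Multiplicative.toAdd (he (HGroup.gen r n r 0))
  have h1 := congrArg Multiplicative.toAdd (he (HGroup.gen r n r 1))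
  rw [HGroup.lift_gen, toAdd_zpow] at h0 h1
  simp only [x, map_zero, map_one, one_ne_zero, if_true, if_false, toAdd_ofAdd, Prod.ext_iff,
    Prod.smul_fst, Prod.smul_snd, smul_eq_mul] at h0 h1
  rcases mul_eq_zero.1 h1.1.symm with h | h
  · simp [h] at h1
  · simp [h] at h0

theorem exceptional_of_isConnectedLOGGroup {n r s : ℕ} (hn : 2 ≤ n) (hrs : r ≠ s)
    (h : IsConnectedLOGGroup (HGroup r n s)) :
    |(r : ℤ) - (s : ℤ)| = 2 ∧ Nat.gcd (Nat.gcd n r) s = 2 ∧ (n ∣ r ∨ n ∣ s) := by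
  obtain ⟨hne, hre, hse, u, v, huv⟩ := X_add_one_eq_of_isConnectedLOGGroup hn hrs h
  have h2 : (r : ℤ) - s ∣ 2 := by
    have := congrArg (Polynomial.eval 1) huv
    simp only [representerPolynomial, Polynomial.eval_add, Polynomial.eval_sub,
      Polynomial.eval_mul, Polynomial.eval_pow, Polynomial.eval_X, Polynomial.eval_one,
      Polynomial.eval_finsetSum, one_pow, Finset.sum_const, Finset.card_range, nsmul_eq_mul,
      mul_one, sub_self, mul_zero, zero_add, one_mul] at this
    exact ⟨v.eval 1, by rw [← one_add_one_eq_two, this, mul_comm]⟩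
  have hle := abs_le.1 (Int.le_of_dvd (by norm_num) ((abs_dvd _ _).2 h2))
  obtain ⟨r', rfl⟩ := hre
  obtain ⟨s', rfl⟩ := hse
  have hcase : s' + s' = r' + r' + 2 ∨ r' + r' = s' + s' + 2 := by push_cast at hle; omega
  refine ⟨?_, Nat.dvd_antisymm ?_ ?_, ?_⟩
  · rcases hcase with h | h <;> rw [h] <;> push_cast <;> ring_nf <;> norm_num
  · have hr := (Nat.gcd_dvd_left (n.gcd (r' + r')) (s' + s')).trans (Nat.gcd_dvd_right _ _)
    have hs := Nat.gcd_dvd_right (n.gcd (r' + r')) (s' + s')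
    rcases hcase with h | h
    · exact (Nat.dvd_add_right hr).1 (h ▸ hs)
    · exact (Nat.dvd_add_right hs).1 (h ▸ hr)
  · exact Nat.dvd_gcd (Nat.dvd_gcd hne.two_dvd ⟨r', by ring⟩) ⟨s', by ring⟩
  -- For `n = 2` the divisibility is just the parity of `r`; the root-of-unity estimate requires `n
  -- > 2`.
  · rcases hn.eq_or_lt with rfl | hn'
    · exact Or.inl ⟨r', by ring⟩
    · exact dvd_or_dvd_of_representerPolynomial hn' hcase huv

theorem mainTheorem4 (r n s : ℕ) (hr : 1 ≤ r) (hs : 1 ≤ s) (hn : 2 ≤ n) :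
    (IsConnectedLOGGroup (HGroup r n s) ↔
      (r = s ∧ Nat.gcd n r = 1) ∨
      (|(r : ℤ) - (s : ℤ)| = 2 ∧ Nat.gcd (Nat.gcd n r) s = 2 ∧
        (r ≡ 0 [MOD n] ∨ s ≡ 0 [MOD n]))) ∧
    (r = s ∧ Nat.gcd n r = 1 → Nonempty (HGroup r n s ≃* TorusKnotGroup n r)) ∧
    (|(r : ℤ) - (s : ℤ)| = 2 ∧ Nat.gcd (Nat.gcd n r) s = 2 ∧
        (r ≡ 0 [MOD n] ∨ s ≡ 0 [MOD n]) →
      Nonempty (HGroup r n s ≃* Multiplicative ℤ)) := by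
  simp only [Nat.modEq_zero_iff_dvd]
  have hexc : |(r : ℤ) - (s : ℤ)| = 2 ∧ Nat.gcd (Nat.gcd n r) s = 2 ∧ (n ∣ r ∨ n ∣ s) →
      Nonempty (HGroup r n s ≃* Multiplicative ℤ) := by
    rintro ⟨habs, hgcd, hdvd⟩
    have h1 : 2 ∣ n.gcd r := hgcd ▸ Nat.gcd_dvd_left (n.gcd r) s
    have h2 : 2 ∣ s := hgcd ▸ Nat.gcd_dvd_right (n.gcd r) s
    refine nonempty_mulEquiv_int (by omega) (even_iff_two_dvd.2 (h1.trans (Nat.gcd_dvd_left n r)))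
      (even_iff_two_dvd.2 (h1.trans (Nat.gcd_dvd_right n r))) (even_iff_two_dvd.2 h2) ?_ hdvd
    rcases (abs_eq (by norm_num)).1 habs with h | h <;> omega
  refine ⟨⟨fun h => ?_, ?_⟩, ?_, hexc⟩
  · by_cases hrs : r = s
    · subst hrs
      exact Or.inl ⟨rfl, coprime_of_isConnectedLOGGroup hn h⟩
    · exact Or.inr (exceptional_of_isConnectedLOGGroup hn hrs h)
  · rintro (⟨rfl, h⟩ | h)
    · exact isConnectedLOGGroup_of_coprime (by omega) (by omega) h
    · obtain ⟨e⟩ := hexc h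
      exact isConnectedLOGGroup_int.of_mulEquiv e
  · rintro ⟨rfl, h⟩
    exact nonempty_mulEquiv_torusKnotGroup hn h
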